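/- Let $X$ be a discrete log-concave random variable on $\mathbb{Z}$, that is, its probability mass function $p(k)=\mathbb{P}(X=k)$ satisfies $p(k)^2\ge p(k-1)\,p(k+1)$ for all $k\in\mathbb{Z}$ and its support $\{k\in\mathbb{Z}: p(k)>0\}$ is an interval of integers (no internal zeros). Let $U$ be uniformly distributed on $[0,1]$ and independent of $X$, and assume $\sigma^2:=\mathrm{Var}(X)\ge 4$. For a real random variable $Y$ let $$C_P(Y)=\sup_{g}\frac{\mathrm{Var}(g(Y))}{\mathbb{E}\bigl[(g'(Y))^2\bigr]}\in[0,\infty]$$ denote its Poincaré constant, where the supremum is over all continuously differentiable $g:\mathbb{R}\to\mathbb{R}$ (with the conventions $0/0=0$, $\infty/\infty=0$, and $a/0=\infty$ for $a>0$). Then $$C_P(X+U)\le 438244\cdot\sigma^2 .$$ -/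

import Mathlib

open MeasureTheory ProbabilityTheory
open scoped ENNReal

/-- A function `p : ℤ → ℝ` (in practice a probability mass function) is discrete log-concave
if `p (k - 1) * p (k + 1) ≤ p k ^ 2` for every integer `k` and its support is an interval of
integers, i.e. it has no internal zeros. -/
structure DiscreteLogConcave (p : ℤ → ℝ) : Prop where
  nonneg : ∀ k, 0 ≤ p k
  sq_ge : ∀ k, p (k - 1) * p (k + 1) ≤ p k ^ 2
  support_interval : (Function.support p).OrdConnected

/-- The probability mass function `k ↦ ℙ(X = k)` of an integer-valued random variable. -/
noncomputable def massFunction {Ω : Type*} [MeasurableSpace Ω] (P : Measure Ω) (X : Ω → ℤ) :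
    ℤ → ℝ :=
  fun k => P.real (X ⁻¹' {k})

/-- The Poincaré constant of a real random variable `Y`: the supremum of
`Var (g(Y)) / 𝔼[g'(Y)²]` over all continuously differentiable `g : ℝ → ℝ`, as an element of
`[0, ∞]`. Variance and expectation are taken in `[0, ∞]`; the conventions of division there are
`0 / 0 = 0`, `∞ / ∞ = 0`, `a / 0 = ∞` for `a ≠ 0`, and `∞ / b = ∞` for `b < ∞`, so that
`poincareConstant P Y ≤ C` with `0 < C < ∞` says that `Var (g(Y)) ≤ C * 𝔼[g'(Y)²]`
for all such `g`. -/
noncomputable def poincareConstant {Ω : Type*} [MeasurableSpace Ω] (P : Measure Ω) (Y : Ω → ℝ) :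
    ℝ≥0∞ :=
  ⨆ (g : ℝ → ℝ) (_ : ContDiff ℝ 1 g),
    evariance (fun ω => g (Y ω)) P / ∫⁻ ω, ENNReal.ofReal ((deriv g (Y ω)) ^ 2) ∂P

/-! ### Tail bounds from log-concavity -/

namespace DiscreteLogConcave

/-! `X + U` has density `p k` on `[k, k + 1]`. Log-concavity forces each tail of `p`, measured from
any `m` with `p m > 0`, to be at most `(p m)⁻¹` times its first term (`tsum_tail_right_mul_le`,
`tsum_tail_left_mul_le`). Such a tail bound yields a Hardy inequality with constant `4 * (p m)⁻¹ ^
2` on each side of `m` for `g - g m` (`sum_mul_integral_sq_le`), and the second moment about `g m`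
dominates the variance. Chebyshev supplies an `m` with `(p m)⁻¹ ≤ 331 σ`, and `4 * 331 ^ 2 =
438244`. -/

theorem eq_zero_or {p : ℤ → ℝ} (hp : DiscreteLogConcave p) {a b c : ℤ} (hab : a ≤ b)
    (hbc : b ≤ c) (hb : p b = 0) : p a = 0 ∨ p c = 0 := by
  by_contra! h
  exact hp.support_interval.out h.1 h.2 ⟨hab, hbc⟩ hb

/-- The ratios `p (k + 1) / p k` are nonincreasing. Cross-multiplying avoids division; where the
factor to cancel vanishes, the absence of internal zeros makes the left side vanish too. -/
theorem succ_mul_le {p : ℤ → ℝ} (hp : DiscreteLogConcave p) (b : ℤ) (n : ℕ) :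
    p (b + n + 1) * p b ≤ p (b + n) * p (b + 1) := by
  induction n with
  | zero => simp [mul_comm]
  | succ n ih =>
    have e : b + ((n + 1 : ℕ) : ℤ) = b + n + 1 := by push_cast; ring
    rw [e]
    have h1 := hp.sq_ge (b + n + 1)
    rw [add_sub_cancel_right] at h1
    have n0 := hp.nonneg (b + n + 1)
    have n1 := hp.nonneg (b + 1)
    rcases (hp.nonneg (b + n)).eq_or_lt' with h0 | h0
    · rcases hp.eq_zero_or (a := b) (c := b + n + 1 + 1) (by omega) (by omega) h0 with h | h <;>
        rw [h] <;> simp <;> positivity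
    · refine le_of_mul_le_mul_left ?_ h0
      calc p (b + n) * (p (b + n + 1 + 1) * p b)
          = (p (b + n) * p (b + n + 1 + 1)) * p b := by ring
        _ ≤ p (b + n + 1) ^ 2 * p b := mul_le_mul_of_nonneg_right h1 (hp.nonneg b)
        _ = p (b + n + 1) * (p (b + n + 1) * p b) := by ring
        _ ≤ p (b + n + 1) * (p (b + n) * p (b + 1)) := mul_le_mul_of_nonneg_left ih n0
        _ = _ := by ring

/-- Shifts of a discrete log-concave function have monotone likelihood ratio. -/
theorem add_mul_le {p : ℤ → ℝ} (hp : DiscreteLogConcave p) {a b : ℤ} (hab : b ≤ a) (i : ℕ) :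
    p (a + i) * p b ≤ p a * p (b + i) := by
  obtain ⟨n, rfl⟩ := Int.le.dest hab
  induction i with
  | zero => simp
  | succ i ih =>
    have step := hp.succ_mul_le (b + i) n
    have e : b + (i : ℤ) + n = b + n + i := by ring
    have e1 : b + (n : ℤ) + ((i + 1 : ℕ) : ℤ) = b + n + i + 1 := by push_cast; ring
    have e2 : b + ((i + 1 : ℕ) : ℤ) = b + i + 1 := by push_cast; ring
    rw [e] at step
    rw [e1, e2]
    have n0 := hp.nonneg (b + n)
    have n1 := hp.nonneg (b + i + 1)
    rcases (hp.nonneg (b + i)).eq_or_lt' with h0 | h0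
    · rcases hp.eq_zero_or (a := b) (c := b + n + i + 1) (by omega) (by omega) h0 with h | h <;>
        rw [h] <;> simp <;> positivity
    · refine le_of_mul_le_mul_left ?_ h0
      calc p (b + i) * (p (b + n + i + 1) * p b)
          = (p (b + n + i + 1) * p (b + i)) * p b := by ring
        _ ≤ (p (b + n + i) * p (b + i + 1)) * p b :=
          mul_le_mul_of_nonneg_right step (hp.nonneg b)
        _ = (p (b + n + i) * p b) * p (b + i + 1) := by ring
        _ ≤ (p (b + n) * p (b + i)) * p (b + i + 1) := mul_le_mul_of_nonneg_right ih n1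
        _ = _ := by ring

/-- Sum the likelihood ratio bound over the shift; the remaining sum is at most the total mass 1. No
mode is needed: any `m` works. -/
theorem tsum_tail_right_mul_le {p : ℤ → ℝ} (hp : DiscreteLogConcave p) (hs : Summable p)
    (h1 : ∑' k, p k = 1) (m : ℤ) (n : ℕ) :
    (∑' i : ℕ, p (m + n + i)) * p m ≤ p (m + n) := by
  have inj : ∀ a : ℤ, Function.Injective fun i : ℕ => a + (i : ℤ) := fun a i j h => by
    simpa using h
  calc (∑' i : ℕ, p (m + n + i)) * p m = ∑' i : ℕ, p (m + n + i) * p m := tsum_mul_right.symm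
    _ ≤ ∑' i : ℕ, p (m + n) * p (m + i) :=
      Summable.tsum_le_tsum (fun i => hp.add_mul_le (by omega) i)
        ((hs.comp_injective (inj _)).mul_right _) ((hs.comp_injective (inj _)).mul_left _)
    _ = p (m + n) * ∑' i : ℕ, p (m + i) := tsum_mul_left
    _ ≤ p (m + n) * 1 := by
      refine mul_le_mul_of_nonneg_left ?_ (hp.nonneg _)
      rw [← h1]
      exact tsum_comp_le_tsum_of_inj hs hp.nonneg (inj m)
    _ = _ := mul_one _

theorem tsum_tail_left_mul_le {p : ℤ → ℝ} (hp : DiscreteLogConcave p) (hs : Summable p)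
    (h1 : ∑' k, p k = 1) (m : ℤ) (n : ℕ) :
    (∑' i : ℕ, p (m - n - i)) * p m ≤ p (m - n) := by
  have inj : ∀ a : ℤ, Function.Injective fun i : ℕ => a - (i : ℤ) := fun a i j h => by
    simpa using h
  calc (∑' i : ℕ, p (m - n - i)) * p m = ∑' i : ℕ, p (m - n - i) * p m := tsum_mul_right.symm
    _ ≤ ∑' i : ℕ, p (m - n) * p (m - i) :=
      Summable.tsum_le_tsum (fun i => by
          have h := hp.add_mul_le (a := m - i) (b := m - n - i) (by omega) i
          rw [sub_add_cancel, sub_add_cancel] at h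
          linarith)
        ((hs.comp_injective (inj _)).mul_right _) ((hs.comp_injective (inj _)).mul_left _)
    _ = p (m - n) * ∑' i : ℕ, p (m - i) := tsum_mul_left
    _ ≤ p (m - n) * 1 := by
      refine mul_le_mul_of_nonneg_left ?_ (hp.nonneg _)
      rw [← h1]
      exact tsum_comp_le_tsum_of_inj hs hp.nonneg (inj m)
    _ = _ := mul_one _

end DiscreteLogConcave

/-! ### Hardy inequality for step weights -/

/-- Integration by parts for `G ^ 2` against an affine tail, on one unit interval. -/
theorem mul_integral_sq_le {G : ℝ → ℝ} (hG : ContDiff ℝ 1 G) {q S h : ℝ} (hq : 0 ≤ q)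
    (hS : q ≤ S) (hSh : S ≤ h * q) (a : ℝ) :
    q * ∫ x in a..a + 1, G x ^ 2 ≤
      2 * (S * G a ^ 2 - (S - q) * G (a + 1) ^ 2) +
        4 * h ^ 2 * (q * ∫ x in a..a + 1, deriv G x ^ 2) := by
  have hc : Continuous G := hG.continuous
  have hc' : Continuous (deriv G) := hG.continuous_deriv le_rfl
  have hd : ∀ x, HasDerivAt G (deriv G x) x := fun x =>
    (hG.differentiable one_ne_zero x).hasDerivAt
  set T : ℝ → ℝ := fun x => S - q * (x - a) with hT
  have hTc : Continuous T := by fun_prop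
  have hF : ∀ x, HasDerivAt (fun x => G x ^ 2 * T x)
      (2 * G x * deriv G x * T x - q * G x ^ 2) x := fun x => by
    have h1 : HasDerivAt T (-(q * 1)) x := (((hasDerivAt_id x).sub_const a).const_mul q).const_sub S
    refine (((hd x).fun_pow 2).fun_mul h1).congr_deriv ?_
    simp only [hT]
    push_cast
    ring
  have hint : ∀ f : ℝ → ℝ, Continuous f → IntervalIntegrable f volume a (a + 1) :=
    fun f hf => hf.intervalIntegrable _ _
  have key := intervalIntegral.integral_eq_sub_of_hasDerivAt (fun x _ => hF x)
    (hint _ (by fun_prop) : IntervalIntegrable _ volume a (a + 1))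
  rw [intervalIntegral.integral_sub (hint _ (by fun_prop)) (hint _ (by fun_prop)), intervalIntegral.integral_const_mul] at key
  -- Young's inequality, weighted so that only half of `q * G ^ 2` appears and can be absorbed on
  -- the left; this gives the factors 2 and 4.
  have bound : ∫ x in a..a + 1, 2 * G x * deriv G x * T x ≤
      ∫ x in a..a + 1, (q / 2 * G x ^ 2 + 2 * h ^ 2 * q * deriv G x ^ 2) := by
    refine intervalIntegral.integral_mono_on (by linarith) (hint _ (by fun_prop)) (hint _ (by fun_prop)) ?_
    intro x hx
    have t0 : 0 ≤ T x := by simp only [hT]; nlinarith [hx.1, hx.2]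
    have t1 : T x ≤ h * q := by simp only [hT]; nlinarith [hx.1, hx.2]
    calc 2 * G x * deriv G x * T x ≤ |2 * G x * deriv G x| * T x :=
          mul_le_mul_of_nonneg_right (le_abs_self _) t0
      _ ≤ |2 * G x * deriv G x| * (h * q) := mul_le_mul_of_nonneg_left t1 (abs_nonneg _)
      _ = q * (2 * |G x| * (h * |deriv G x|)) := by rw [abs_mul, abs_mul]; norm_num; ring
      _ ≤ q * (|G x| ^ 2 / 2 + 2 * h ^ 2 * |deriv G x| ^ 2) :=
          mul_le_mul_of_nonneg_left (by nlinarith [sq_nonneg (|G x| - 2 * h * |deriv G x|)]) hq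
      _ = _ := by rw [sq_abs, sq_abs]; ring
  rw [intervalIntegral.integral_add (hint _ (by fun_prop)) (hint _ (by fun_prop)), intervalIntegral.integral_const_mul,
    intervalIntegral.integral_const_mul] at bound
  have e1 : T a = S := by simp [hT]
  have e2 : T (a + 1) = S - q := by simp [hT]
  rw [e1, e2] at key
  linarith

/-- A Hardy inequality on the half line for a step function weight with controlled tails. -/
theorem sum_mul_integral_sq_le {G : ℝ → ℝ} (hG : ContDiff ℝ 1 G) (hG0 : G 0 = 0) {q S : ℕ → ℝ}
    {h : ℝ} (hq : ∀ n, 0 ≤ q n) (hS0 : ∀ n, 0 ≤ S n) (hS : ∀ n, S n = q n + S (n + 1))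
    (hSh : ∀ n, S n ≤ h * q n) (N : ℕ) :
    ∑ n ∈ Finset.range N, q n * ∫ x in (n : ℝ)..n + 1, G x ^ 2 ≤
      4 * h ^ 2 * ∑ n ∈ Finset.range N, q n * ∫ x in (n : ℝ)..n + 1, deriv G x ^ 2 := by
  -- Keeping the boundary term makes the unit-interval estimates telescope; `G 0 = 0` removes the
  -- initial one.
  suffices H : ∑ n ∈ Finset.range N, q n * ∫ x in (n : ℝ)..n + 1, G x ^ 2 ≤
      4 * h ^ 2 * ∑ n ∈ Finset.range N, q n * (∫ x in (n : ℝ)..n + 1, deriv G x ^ 2)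
        - 2 * (S N * G N ^ 2) by
    have := mul_nonneg (hS0 N) (sq_nonneg (G N))
    linarith
  induction N with
  | zero => simp [hG0]
  | succ N ih =>
    rw [Finset.sum_range_succ, Finset.sum_range_succ]
    have := mul_integral_sq_le hG (hq N) (by linarith [hS N, hS0 (N + 1)]) (hSh N) (N : ℝ)
    have e : S N - q N = S (N + 1) := by linarith [hS N]
    rw [e] at this
    push_cast
    linarith

theorem lintegral_Icc_comp_add {f : ℝ → ℝ} (hf : Continuous f) (h0 : ∀ x, 0 ≤ f x) (a : ℝ) :
    ∫⁻ u in Set.Icc (0 : ℝ) 1, ENNReal.ofReal (f (a + u)) =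
      ENNReal.ofReal (∫ x in a..a + 1, f x) := by
  have hc : Continuous fun u => f (a + u) := by fun_prop
  rw [← ofReal_integral_eq_lintegral_ofReal (hc.continuousOn.integrableOn_Icc)
    (Filter.Eventually.of_forall fun _ => h0 _), integral_Icc_eq_integral_Ioc,
    ← intervalIntegral.integral_of_le zero_le_one, intervalIntegral.integral_comp_add_left]
  simp

/-! ### Two-sided inequality around `m` -/

theorem DiscreteLogConcave.sum_right_le {p : ℤ → ℝ} (hp : DiscreteLogConcave p) (hs : Summable p)
    (h1 : ∑' k, p k = 1) {m : ℤ} (hm : 0 < p m) {g : ℝ → ℝ} (hg : ContDiff ℝ 1 g) (N : ℕ) :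
    ∑ n ∈ Finset.range N, p (m + n) *
        ∫ x in ((m + n : ℤ) : ℝ)..(m + n : ℤ) + 1, (g x - g m) ^ 2 ≤
      4 * (p m)⁻¹ ^ 2 * ∑ n ∈ Finset.range N, p (m + n) *
        ∫ x in ((m + n : ℤ) : ℝ)..(m + n : ℤ) + 1, deriv g x ^ 2 := by
  have inj : ∀ a : ℤ, Function.Injective fun i : ℕ => a + (i : ℤ) := fun a i j h => by
    simpa using h
  have key := sum_mul_integral_sq_le (G := fun x => g (m + x) - g m) (by fun_prop) (by simp)
    (q := fun n => p (m + n)) (S := fun n => ∑' i : ℕ, p (m + n + i)) (h := (p m)⁻¹)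
    (fun n => hp.nonneg _) (fun n => tsum_nonneg fun i => hp.nonneg _)
    (fun n => by
      refine (hs.comp_injective (inj (m + n))).tsum_eq_zero_add.trans ?_
      congr 1
      · simp
      · refine tsum_congr fun i => congrArg p ?_
        push_cast
        ring)
    (fun n => by
      rw [inv_mul_eq_div, le_div_iff₀ hm]
      exact hp.tsum_tail_right_mul_le hs h1 m n) N
  have hd : deriv (fun x => g (m + x) - g m) = fun x => deriv g (m + x) := by
    ext x
    rw [deriv_sub_const, deriv_comp_const_add]
  rw [hd] at key
  have e : ∀ (f : ℝ → ℝ) (n : ℕ), ∫ x in (n : ℝ)..n + 1, f (m + x) =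
      ∫ x in ((m + n : ℤ) : ℝ)..(m + n : ℤ) + 1, f x := fun f n => by
    rw [intervalIntegral.integral_comp_add_left]
    push_cast
    rw [add_assoc]
  simpa only [e (fun x => (g x - g m) ^ 2), e (fun x => deriv g x ^ 2)] using key

/-- Reflection at `m` turns cell `n` of the half line into `[m - (n + 1), m - n]`, whose weight sits
at its left end, hence the shift by one. -/
theorem DiscreteLogConcave.sum_left_le {p : ℤ → ℝ} (hp : DiscreteLogConcave p) (hs : Summable p)
    (h1 : ∑' k, p k = 1) {m : ℤ} (hm : 0 < p m) {g : ℝ → ℝ} (hg : ContDiff ℝ 1 g) (N : ℕ) :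
    ∑ n ∈ Finset.range N, p (m + -(n + 1)) *
        ∫ x in ((m + -(n + 1) : ℤ) : ℝ)..(m + -(n + 1) : ℤ) + 1, (g x - g m) ^ 2 ≤
      4 * (p m)⁻¹ ^ 2 * ∑ n ∈ Finset.range N, p (m + -(n + 1)) *
        ∫ x in ((m + -(n + 1) : ℤ) : ℝ)..(m + -(n + 1) : ℤ) + 1, deriv g x ^ 2 := by
  have inj : ∀ a : ℤ, Function.Injective fun i : ℕ => a - (i : ℤ) := fun a i j h => by
    simpa using h
  have e0 : ∀ n : ℕ, m - ((n + 1 : ℕ) : ℤ) = m + -(n + 1) := fun n => by push_cast; ring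
  have key := sum_mul_integral_sq_le (G := fun x => g (m - x) - g m) (by fun_prop) (by simp)
    (q := fun n => p (m + -(n + 1))) (S := fun n => ∑' i : ℕ, p (m + -(n + 1) - i))
    (h := (p m)⁻¹)
    (fun n => hp.nonneg _) (fun n => tsum_nonneg fun i => hp.nonneg _)
    (fun n => by
      refine (hs.comp_injective (inj (m + -(n + 1)))).tsum_eq_zero_add.trans ?_
      congr 1
      · simp
      · refine tsum_congr fun i => congrArg p ?_
        push_cast
        ring)
    (fun n => by
      rw [inv_mul_eq_div, le_div_iff₀ hm, ← e0]
      exact hp.tsum_tail_left_mul_le hs h1 m (n + 1)) N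
  have hd : deriv (fun x => g (m - x) - g m) = fun x => -deriv g (m - x) := by
    ext x
    rw [deriv_sub_const, deriv_comp_const_sub]
  rw [hd] at key
  have e : ∀ (f : ℝ → ℝ) (n : ℕ), ∫ x in (n : ℝ)..n + 1, f (m - x) =
      ∫ x in ((m + -(n + 1) : ℤ) : ℝ)..(m + -(n + 1) : ℤ) + 1, f x := fun f n => by
    rw [intervalIntegral.integral_comp_sub_left]
    push_cast
    ring_nf
  simpa only [neg_sq, e (fun x => (g x - g m) ^ 2), e (fun x => deriv g x ^ 2)] using key

theorem ENNReal.tsum_ofReal_le_of_sum_range_le {a b : ℕ → ℝ} (ha : ∀ n, 0 ≤ a n)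
    (hb : ∀ n, 0 ≤ b n) {C : ℝ} (hC : 0 ≤ C)
    (h : ∀ N, ∑ n ∈ Finset.range N, a n ≤ C * ∑ n ∈ Finset.range N, b n) :
    ∑' n, ENNReal.ofReal (a n) ≤ ENNReal.ofReal C * ∑' n, ENNReal.ofReal (b n) := by
  rw [ENNReal.tsum_eq_iSup_nat]
  refine iSup_le fun N => ?_
  calc ∑ n ∈ Finset.range N, ENNReal.ofReal (a n)
      = ENNReal.ofReal (∑ n ∈ Finset.range N, a n) :=
        (ENNReal.ofReal_sum_of_nonneg fun n _ => ha n).symm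
    _ ≤ ENNReal.ofReal (C * ∑ n ∈ Finset.range N, b n) := ENNReal.ofReal_le_ofReal (h N)
    _ = ENNReal.ofReal C * ∑ n ∈ Finset.range N, ENNReal.ofReal (b n) := by
        rw [ENNReal.ofReal_mul hC, ENNReal.ofReal_sum_of_nonneg fun n _ => hb n]
    _ ≤ _ := mul_le_mul_right (ENNReal.sum_le_tsum _) _

theorem Int.tsum_eq_tsum_add_tsum (f : ℤ → ℝ≥0∞) (m : ℤ) :
    ∑' k, f k = ∑' n : ℕ, f (m + n) + ∑' n : ℕ, f (m + -(n + 1)) := by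
  rw [← (Equiv.addLeft m).tsum_eq f]
  exact tsum_of_nat_of_neg_add_one (f := fun k => f (m + k)) ENNReal.summable ENNReal.summable

/-- A Poincaré-type inequality, with values centred at `m`, for the density equal to `p k` on
`[k, k + 1]`. -/
theorem DiscreteLogConcave.tsum_lintegral_le {p : ℤ → ℝ} (hp : DiscreteLogConcave p)
    (hs : Summable p) (h1 : ∑' k, p k = 1) {m : ℤ} (hm : 0 < p m) {g : ℝ → ℝ}
    (hg : ContDiff ℝ 1 g) :
    ∑' k : ℤ, ENNReal.ofReal (p k) *
        ∫⁻ u in Set.Icc (0 : ℝ) 1, ENNReal.ofReal ((g (k + u) - g m) ^ 2) ≤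
      ENNReal.ofReal (4 * (p m)⁻¹ ^ 2) * ∑' k : ℤ, ENNReal.ofReal (p k) *
        ∫⁻ u in Set.Icc (0 : ℝ) 1, ENNReal.ofReal (deriv g (k + u) ^ 2) := by
  have hc : Continuous g := hg.continuous
  have hc' : Continuous (deriv g) := hg.continuous_deriv le_rfl
  have e : ∀ f : ℝ → ℝ, Continuous f → (∀ x, 0 ≤ f x) → ∀ k : ℤ, ENNReal.ofReal (p k) *
      ∫⁻ u in Set.Icc (0 : ℝ) 1, ENNReal.ofReal (f (k + u)) =
      ENNReal.ofReal (p k * ∫ x in (k : ℝ)..k + 1, f x) := fun f hf h0 k => by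
    rw [lintegral_Icc_comp_add hf h0, ENNReal.ofReal_mul (hp.nonneg k)]
  have n : ∀ f : ℝ → ℝ, (∀ x, 0 ≤ f x) → ∀ k : ℤ, 0 ≤ p k * ∫ x in (k : ℝ)..k + 1, f x :=
    fun f h0 k => mul_nonneg (hp.nonneg k)
      (intervalIntegral.integral_nonneg (by linarith) fun x _ => h0 x)
  simp only [e (fun x => (g x - g m) ^ 2) (by fun_prop) (fun x => sq_nonneg _),
    e (fun x => deriv g x ^ 2) (by fun_prop) (fun x => sq_nonneg _)]
  rw [Int.tsum_eq_tsum_add_tsum _ m, Int.tsum_eq_tsum_add_tsum _ m, mul_add]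
  exact add_le_add
    (ENNReal.tsum_ofReal_le_of_sum_range_le (fun _ => n _ (fun x => sq_nonneg _) _)
      (fun _ => n _ (fun x => sq_nonneg _) _) (by positivity) (hp.sum_right_le hs h1 hm hg))
    (ENNReal.tsum_ofReal_le_of_sum_range_le (fun _ => n _ (fun x => sq_nonneg _) _)
      (fun _ => n _ (fun x => sq_nonneg _) _) (by positivity) (hp.sum_left_le hs h1 hm hg))

/-! ### Law of `X + U`, variance and a large atom -/

section Probability

variable {Ω : Type*} [MeasurableSpace Ω] {P : Measure Ω} [IsProbabilityMeasure P]

theorem hasSum_massFunction {X : Ω → ℤ} (hX : Measurable X) : HasSum (massFunction P X) 1 := by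
  have := Measure.isProbabilityMeasure_map (μ := P) hX.aemeasurable
  have h : ∑' k, P (X ⁻¹' {k}) = 1 := by
    have h1 := lintegral_countable' (μ := P.map X) fun _ => 1
    simp only [lintegral_const, measure_univ, one_mul] at h1
    rw [h1]
    exact tsum_congr fun k => (Measure.map_apply hX (measurableSet_singleton k)).symm
  have h2 := ENNReal.hasSum_toReal (h.trans_ne ENNReal.one_ne_top)
  rwa [← ENNReal.tsum_toReal_eq fun _ => measure_ne_top _ _, h, ENNReal.toReal_one] at h2

theorem lintegral_comp_add_uniform {X : Ω → ℤ} {U : Ω → ℝ} (hX : Measurable X)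
    (hU : Measurable U) (hunif : pdf.IsUniform U (Set.Icc (0 : ℝ) 1) P volume)
    (hindep : IndepFun X U P) {φ : ℝ → ℝ≥0∞} (hφ : Measurable φ) :
    ∫⁻ ω, φ (X ω + U ω) ∂P =
      ∑' k : ℤ, ENNReal.ofReal (massFunction P X k) * ∫⁻ u in Set.Icc (0 : ℝ) 1, φ (k + u) := by
  have hm : Measurable fun z : ℤ × ℝ => φ (z.1 + z.2) := by fun_prop
  have hmap := (indepFun_iff_map_prod_eq_prod_map_map hX.aemeasurable hU.aemeasurable).1 hindep
  have hu : P.map U = volume.restrict (Set.Icc (0 : ℝ) 1) := by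
    rw [hunif, ProbabilityTheory.cond]
    simp
  calc ∫⁻ ω, φ (X ω + U ω) ∂P = ∫⁻ z, φ (z.1 + z.2) ∂(P.map fun ω => (X ω, U ω)) :=
        (lintegral_map hm (hX.prodMk hU)).symm
    _ = _ := by
      have := Measure.isProbabilityMeasure_map (μ := P) hU.aemeasurable
      rw [hmap, lintegral_prod _ hm.aemeasurable, lintegral_countable', hu]
      refine tsum_congr fun k => ?_
      rw [Measure.map_apply hX (measurableSet_singleton k), mul_comm, massFunction,
        ofReal_measureReal]

theorem evariance_le_lintegral_sub_sq {Z : Ω → ℝ} (hZ : Measurable Z) (c : ℝ) :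
    evariance Z P ≤ ∫⁻ ω, ENNReal.ofReal ((Z ω - c) ^ 2) ∂P := by
  have hm : AEStronglyMeasurable (fun ω => Z ω - c) P := (hZ.sub_const c).aestronglyMeasurable
  by_cases h : MemLp (fun ω => Z ω - c) 2 P
  · have hZ2 : MemLp Z 2 P := by
      convert h.add (memLp_const c) using 1
      ext ω
      simp
    rw [← ofReal_integral_eq_lintegral_ofReal h.integrable_sq
      (Filter.Eventually.of_forall fun _ => sq_nonneg _), ← ofReal_variance hZ2,
      ← variance_sub_const hZ.aestronglyMeasurable c]
    exact ENNReal.ofReal_le_ofReal (variance_le_expectation_sq hm)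
  · have : ∫⁻ ω, ENNReal.ofReal ((Z ω - c) ^ 2) ∂P = ∞ := by
      by_contra ht
      refine h ((memLp_two_iff_integrable_sq hm).2 ⟨hm.pow 2, ?_⟩)
      rw [hasFiniteIntegral_iff_ofReal (Filter.Eventually.of_forall fun _ => sq_nonneg _)]
      exact lt_top_iff_ne_top.2 ht
    rw [this]
    exact le_top

/-- At least 3/4 of the mass lies within `2 * s` of the mean, on at most `4 * s + 1` integers, so
the atoms there cannot all be small. The constant 331 is far from tight. -/
theorem exists_inv_le_massFunction {X : Ω → ℤ} (hX : Measurable X)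
    (hvar : 4 ≤ variance (fun ω => (X ω : ℝ)) P) :
    ∃ m, (331 * √(variance (fun ω => (X ω : ℝ)) P))⁻¹ ≤ massFunction P X m := by
  set V := variance (fun ω => (X ω : ℝ)) P with hV
  set s := √V with hs
  have hss : s ^ 2 = V := Real.sq_sqrt (by linarith)
  have hs2 : 2 ≤ s := Real.le_sqrt_of_sq_le (by linarith)
  have hXm : Measurable fun ω => (X ω : ℝ) := by fun_prop
  -- The real-valued `variance` is 0 when the second moment is infinite, so the lower bound on it
  -- gives square integrability.
  have hmem : MemLp (fun ω => (X ω : ℝ)) 2 P :=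
    memLp_two_of_variance_ne_zero hXm.aestronglyMeasurable (by rw [← hV]; linarith)
  set μ := ∫ ω, (X ω : ℝ) ∂P with hμ
  have cheb := meas_ge_le_variance_div_sq hmem (c := 2 * s) (by positivity)
  by_contra! hlt
  set K := Finset.Icc ⌈μ - 2 * s⌉ ⌊μ + 2 * s⌋ with hK
  have hcard : (K.card : ℝ) ≤ 4 * s + 1 := by
    rw [hK, Int.card_Icc]
    have a1 := Int.le_ceil (μ - 2 * s)
    have a2 := Int.floor_le (μ + 2 * s)
    rcases le_total 0 (⌊μ + 2 * s⌋ + 1 - ⌈μ - 2 * s⌉) with h | h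
    · have : (((⌊μ + 2 * s⌋ + 1 - ⌈μ - 2 * s⌉).toNat : ℤ) : ℝ) =
        ((⌊μ + 2 * s⌋ + 1 - ⌈μ - 2 * s⌉ : ℤ) : ℝ) := by rw [Int.toNat_of_nonneg h]
      push_cast at this
      linarith
    · rw [Int.toNat_of_nonpos h]
      simp
      linarith
  have hPK : P.real (X ⁻¹' K) ≤ (4 * s + 1) * (331 * s)⁻¹ := by
    calc P.real (X ⁻¹' K) = P.real (⋃ k ∈ K, X ⁻¹' {k}) := by
          congr 1
          ext ω
          simp
      _ ≤ ∑ k ∈ K, P.real (X ⁻¹' {k}) := measureReal_biUnion_finset_le _ _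
      _ ≤ ∑ _k ∈ K, (331 * s)⁻¹ := Finset.sum_le_sum fun k _ => (hlt k).le
      _ = K.card * (331 * s)⁻¹ := by simp
      _ ≤ _ := mul_le_mul_of_nonneg_right hcard (by positivity)
  have hPc : P.real {ω | 2 * s ≤ |(X ω : ℝ) - μ|} ≤ 1 / 4 := by
    refine ENNReal.toReal_le_of_le_ofReal (by norm_num) (cheb.trans_eq ?_)
    congr 1
    rw [← hV, mul_pow, hss]
    field_simp
    norm_num
  have hcover : (Set.univ : Set Ω) ⊆ X ⁻¹' K ∪ {ω | 2 * s ≤ |(X ω : ℝ) - μ|} := by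
    intro ω _
    by_cases h : 2 * s ≤ |(X ω : ℝ) - μ|
    · exact Or.inr h
    · left
      obtain ⟨h1, h2⟩ := abs_lt.1 (not_le.1 h)
      simp only [hK, Set.mem_preimage, Finset.mem_coe, Finset.mem_Icc]
      exact ⟨Int.ceil_le.2 (by linarith), Int.le_floor.2 (by linarith)⟩
  have hone : (1 : ℝ) ≤ P.real (X ⁻¹' K) + P.real {ω | 2 * s ≤ |(X ω : ℝ) - μ|} := by
    calc (1 : ℝ) = P.real Set.univ := by simp
      _ ≤ _ := measureReal_mono hcover
      _ ≤ _ := measureReal_union_le _ _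
  have : (4 * s + 1) * (331 * s)⁻¹ ≤ 1 / 2 := by
    rw [← div_eq_mul_inv, div_le_iff₀ (by positivity)]
    linarith
  linarith

end Probability

theorem proposition2 {Ω : Type*} [MeasurableSpace Ω] (P : Measure Ω) [IsProbabilityMeasure P]
    (X : Ω → ℤ) (U : Ω → ℝ) (hX : Measurable X) (hU : Measurable U)
    (hlc : DiscreteLogConcave (massFunction P X))
    (hunif : pdf.IsUniform U (Set.Icc (0 : ℝ) 1) P volume)
    (hindep : IndepFun X U P)
    (hvar : 4 ≤ variance (fun ω => (X ω : ℝ)) P) :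
    poincareConstant P (fun ω => (X ω : ℝ) + U ω) ≤
      ENNReal.ofReal (438244 * variance (fun ω => (X ω : ℝ)) P) := by
  obtain ⟨m, hm⟩ := exists_inv_le_massFunction hX hvar
  set V := variance (fun ω => (X ω : ℝ)) P
  have hV : 0 < √V := Real.sqrt_pos.2 (by linarith)
  have hm0 : 0 < massFunction P X m := lt_of_lt_of_le (by positivity) hm
  have hsum := hasSum_massFunction (P := P) hX
  refine iSup₂_le fun g hg => ENNReal.div_le_of_le_mul ?_
  have hc : Continuous g := hg.continuous
  have hc' : Continuous (deriv g) := hg.continuous_deriv le_rfl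
  have hconst : 4 * (massFunction P X m)⁻¹ ^ 2 ≤ 438244 * V := by
    calc 4 * (massFunction P X m)⁻¹ ^ 2 ≤ 4 * (331 * √V) ^ 2 := by
          gcongr
          exact inv_le_of_inv_le₀ (by positivity) hm
      _ = 438244 * √V ^ 2 := by ring
      _ = 438244 * V := by rw [Real.sq_sqrt (by linarith)]
  calc evariance (fun ω => g (X ω + U ω)) P
      ≤ ∫⁻ ω, ENNReal.ofReal ((g (X ω + U ω) - g m) ^ 2) ∂P :=
        evariance_le_lintegral_sub_sq (by fun_prop) _
    _ ≤ ENNReal.ofReal (4 * (massFunction P X m)⁻¹ ^ 2) *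
        ∫⁻ ω, ENNReal.ofReal (deriv g (X ω + U ω) ^ 2) ∂P := by
      rw [lintegral_comp_add_uniform hX hU hunif hindep
          (φ := fun y => ENNReal.ofReal ((g y - g m) ^ 2)) (by fun_prop),
        lintegral_comp_add_uniform hX hU hunif hindep
          (φ := fun y => ENNReal.ofReal (deriv g y ^ 2)) (by fun_prop)]
      exact hlc.tsum_lintegral_le hsum.summable hsum.tsum_eq hm0 hg
    _ ≤ _ := mul_le_mul_left (ENNReal.ofReal_le_ofReal hconst) _
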